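/- Let $d,n\in\mathbb N$ with $n\ge 1$, let $r>0$, $\delta\in(0,1)$ and $\alpha\in(0,\infty]$. Let $P_{X,Y}$ be an arbitrary probability distribution of a pair $(X,Y)$ with $X\in[0,1]^d$ and $Y\in\{-1,+1\}$ almost surely, and let $(X_1,Y_1),\dots,(X_n,Y_n)$ be independent samples drawn from $P_{X,Y}$. Write $\sigma(z)=\frac{1}{1+e^{-z}}$ and $\mathbb B_d(r)=\{\theta\in\mathbb R^d:\|\theta\|_2\le r\}$. For $\theta\in\mathbb R^d$ let $g_\theta(x)=\sigma(\langle\theta,x\rangle)$ and let $$l^\alpha(y,g_\theta(x))=\frac{\alpha}{\alpha-1}\Bigl(1-g_\theta(yx)^{1-1/\alpha}\Bigr)\quad(\alpha\ne 1,\infty),\qquad l^1(y,g_\theta(x))=-\log g_\theta(yx),\qquad l^\infty(y,g_\theta(x))=1-g_\theta(yx)$$ be the $\alpha$-loss of the logistic model. Let $$R_\alpha(\theta)=\mathbb E\bigl[l^\alpha(Y,g_\theta(X))\bigr],\qquad \hat R_\alpha(\theta)=\frac1n\sum_{i=1}^n l^\alpha(Y_i,g_\theta(X_i)).$$ For $r_0\ge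 0$ put $$C_{r_0}(\alpha)=\begin{cases}\sigma(r_0)\,\sigma(-r_0)^{1-1/\alpha},&\alpha\in(0,1],\\[2pt]\bigl(\frac{\alpha-1}{2\alpha-1}\bigr)^{1-1/\alpha}\,\frac{\alpha}{2\alpha-1},&\alpha\in(1,\infty),\\[2pt]\frac14,&\alpha=\infty,\end{cases} \qquad D_{r_0}(\alpha)=\begin{cases}\frac{\alpha}{\alpha-1}\bigl(1-\sigma(-r_0)^{1-1/\alpha}\bigr),&\alpha\in(0,1)\cup(1,\infty),\\[2pt]-\log\sigma(-r_0),&\alpha=1,\\[2pt]1-\sigma(-r_0),&\alpha=\infty.\end{cases}$$ **Theorem.** With probability at least $1-\delta$ over the samples, for all $\theta\in\mathbb B_d(r)$ simultaneously, $$\bigl|R_\alpha(\theta)-\hat R_\alpha(\theta)\bigr|\le C_{r\sqrt d}(\alpha)\,\frac{2r\sqrt d}{\sqrt n}+4\,D_{r\sqrt d}(\alpha)\sqrt{\frac{2\log(4/\delta)}{n}}.$$ -/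

import Mathlib

open scoped ENNReal
open MeasureTheory ProbabilityTheory

noncomputable section

namespace AlphaLoss

/-- The `α`-loss, `α ∈ (0, ∞]`, as a function of the probability `p` assigned to the true label:
`α / (α - 1) * (1 - p ^ (1 - 1 / α))`, with its continuous extensions `- log p` at `α = 1`
and `1 - p` at `α = ∞`. -/
def probLoss (α : ℝ≥0∞) (p : ℝ) : ℝ :=
  if α = ⊤ then 1 - p
  else if α = 1 then -Real.log p
  else α.toReal / (α.toReal - 1) * (1 - p ^ (1 - 1 / α.toReal))

/-- The logistic model `g_θ(x) = σ(⟨θ, x⟩)`, with `σ(z) = 1 / (1 + e^{-z})`. -/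
def logistic {d : ℕ} (θ x : EuclideanSpace ℝ (Fin d)) : ℝ :=
  Real.sigmoid (inner ℝ θ x)

/-- The `α`-loss of the logistic model at the labelled feature `(x, y)`, `y ∈ {-1, +1}`. The
probability that the model gives to the label `y` is `g_θ(y x)`. -/
def logisticLoss {d : ℕ} (α : ℝ≥0∞) (θ x : EuclideanSpace ℝ (Fin d)) (y : ℝ) : ℝ :=
  probLoss α (logistic θ (y • x))

/-- The `α`-risk `R_α(θ) = E[l^α(Y, g_θ(X))]` for `(X, Y)` distributed according to `P`. -/
def risk {d : ℕ} (P : Measure (EuclideanSpace ℝ (Fin d) × ℝ)) (α : ℝ≥0∞)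
    (θ : EuclideanSpace ℝ (Fin d)) : ℝ :=
  ∫ z, logisticLoss α θ z.1 z.2 ∂P

/-- The empirical `α`-risk of `θ` on the training set `(x₁, y₁), …, (xₙ, yₙ)`. -/
def empiricalRisk {d n : ℕ} (x : Fin n → EuclideanSpace ℝ (Fin d)) (y : Fin n → ℝ) (α : ℝ≥0∞)
    (θ : EuclideanSpace ℝ (Fin d)) : ℝ :=
  1 / (n : ℝ) * ∑ i, logisticLoss α θ (x i) (y i)

/-- The constant `C_{r₀}(α)`. At `α = ∞` the expression
`((α - 1) / (2α - 1)) ^ (1 - 1 / α) * (α / (2α - 1))` is read as its limit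
`(1 / 2) * (1 / 2)`. -/
def lipConst (r₀ : ℝ) (α : ℝ≥0∞) : ℝ :=
  if α = ⊤ then 1 / 4
  else if α ≤ 1 then
    Real.sigmoid r₀ * Real.sigmoid (-r₀) ^ (1 - 1 / α.toReal)
  else
    ((α.toReal - 1) / (2 * α.toReal - 1)) ^ (1 - 1 / α.toReal) *
      (α.toReal / (2 * α.toReal - 1))

/-- The constant `D_{r₀}(α) = α / (α - 1) * (1 - σ(-r₀) ^ (1 - 1 / α))`, extended by continuity
to `α = 1` and `α = ∞`. -/
def boundConst (r₀ : ℝ) (α : ℝ≥0∞) : ℝ :=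
  if α = ⊤ then 1 - Real.sigmoid (-r₀)
  else if α = 1 then -Real.log (Real.sigmoid (-r₀))
  else α.toReal / (α.toReal - 1) * (1 - Real.sigmoid (-r₀) ^ (1 - 1 / α.toReal))

end AlphaLoss

end

/-!
The deviation `R_α(θ) - R̂_α(θ)` is controlled through Rademacher averages, with all the randomness
of the signs treated by finite averages over the cube `{±1} ^ n` (`signAvg`).

As a function of the margin `t = ⟨θ, y x⟩ ∈ [-r√d, r√d]` the `α`-loss takes values in
`[0, D_{r√d}(α)]` and has derivative `-σ(t) ^ (1 - 1 / α) * (1 - σ(t))`, whose absolute value is at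
most `C_{r√d}(α)` (`rpow_mul_one_sub_sigmoid_le_lipConst`). By the Ledoux–Talagrand contraction
principle (`signAvg_iSup_contraction`) the Rademacher average of the losses over the ball is
therefore at most `C_{r√d}(α)` times that of the linear functions `⟨θ, ·⟩`, which is at most
`r * √d * √n` (`signAvg_iSup_lipschitz_inner_le`).

Concentration comes from the same signs. Jensen's inequality for a ghost sample and the
exchangeability of the two samples bound the exponential moment of the largest deviation by one
over random signs (`integral_exp_iSup_le`). A bounded-difference inequality on the cube
(`signAvg_exp_iSup_le`) estimates that by its mean, at most twice the Rademacher average, and a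
Gaussian factor with variance proxy `n * D ^ 2`. Chernoff's bound then gives each side of the
inequality with room to spare in the constants.

Only maxima over finite families of parameters occur in this argument. The whole ball is reached
through a dense sequence, by continuity in `θ` and continuity of measure along increasing events
(`measure_exists_abs_deviation_gt_le`).
-/

namespace AlphaLoss

/-! ### Averages over random signs -/

/-- The sign `±1` encoded by a Boolean. -/
def boolSign (b : Bool) : ℝ := if b then 1 else -1

/-- The average of `F` over the `2 ^ n` sign patterns, i.e. the expectation of `F` under `n`
independent Rademacher signs. -/
noncomputable def signAvg (n : ℕ) (F : (Fin n → Bool) → ℝ) : ℝ := (∑ ε, F ε) / 2 ^ n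

lemma abs_boolSign (b : Bool) : |boolSign b| = 1 := by cases b <;> simp [boolSign]

lemma boolSign_not (b : Bool) : boolSign (!b) = -boolSign b := by cases b <;> simp [boolSign]

lemma signAvg_zero (F : (Fin 0 → Bool) → ℝ) : signAvg 0 F = F Fin.elim0 := by
  simp only [signAvg, pow_zero, div_one]
  rw [Fintype.sum_unique]
  exact congrArg F (Subsingleton.elim _ _)

lemma signAvg_succ {n : ℕ} (F : (Fin (n + 1) → Bool) → ℝ) :
    signAvg (n + 1) F = (signAvg n (fun ε => F (Fin.cons true ε)) +
      signAvg n (fun ε => F (Fin.cons false ε))) / 2 := by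
  have h : ∑ ε, F ε = ∑ p : Bool × (Fin n → Bool), F (Fin.cons p.1 p.2) :=
    (Equiv.sum_comp (Fin.consEquiv (fun _ : Fin (n + 1) => Bool)) F).symm
  simp only [signAvg, h, Fintype.sum_prod_type, Fintype.sum_bool]
  rw [pow_succ]
  field_simp

lemma signAvg_mono {n : ℕ} {F G : (Fin n → Bool) → ℝ} (h : ∀ ε, F ε ≤ G ε) :
    signAvg n F ≤ signAvg n G := by
  unfold signAvg
  gcongr with ε
  exact h ε

lemma signAvg_const (n : ℕ) (c : ℝ) : signAvg n (fun _ => c) = c := by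
  simp [signAvg]

lemma signAvg_add {n : ℕ} (F G : (Fin n → Bool) → ℝ) :
    signAvg n (fun ε => F ε + G ε) = signAvg n F + signAvg n G := by
  simp [signAvg, Finset.sum_add_distrib, add_div]

lemma signAvg_mul_left {n : ℕ} (c : ℝ) (F : (Fin n → Bool) → ℝ) :
    signAvg n (fun ε => c * F ε) = c * signAvg n F := by
  simp [signAvg, ← Finset.mul_sum, mul_div_assoc]

/-- Flipping all the signs does not change an average. -/
lemma signAvg_comp_not {n : ℕ} (F : (Fin n → Bool) → ℝ) :
    signAvg n (fun ε => F (fun i => !ε i)) = signAvg n F := by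
  unfold signAvg
  congr 1
  exact Equiv.sum_comp (Equiv.piCongrRight (fun _ : Fin n => Equiv.boolNot)) F

lemma sum_boolSign_cons_mul {n : ℕ} (b : Bool) (ε : Fin n → Bool) (a : Fin (n + 1) → ℝ) :
    ∑ i, boolSign ((Fin.cons b ε : Fin (n + 1) → Bool) i) * a i =
      boolSign b * a 0 + ∑ i, boolSign (ε i) * a i.succ := by
  simp [Fin.sum_univ_succ]

section Finite

variable {J : Type*} [Finite J]

lemma le_iSup_of_finite (f : J → ℝ) (j : J) : f j ≤ ⨆ j, f j :=
  le_ciSup (Set.finite_range f).bddAbove j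

variable [Nonempty J]

lemma iSup_le_iSup_add (f g : J → ℝ) {c : ℝ} (h : ∀ j, f j ≤ g j + c) :
    ⨆ j, f j ≤ (⨆ j, g j) + c :=
  ciSup_le fun j => (h j).trans (by gcongr; exact le_iSup_of_finite g j)

/-! ### The contraction principle -/

/-- The one-coordinate case of the contraction principle: if `j` and `k` attain the two suprema on
the left, then `|u j - u k| ≤ |v j - v k|` shows that the pair `(j, k)` or the pair `(k, j)` does
at least as well on the right. -/
lemma iSup_add_add_iSup_sub_le (A u v : J → ℝ) (h : ∀ j k, |u j - u k| ≤ |v j - v k|) :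
    (⨆ j, (A j + u j)) + (⨆ j, (A j - u j)) ≤ (⨆ j, (A j + v j)) + ⨆ j, (A j - v j) := by
  obtain ⟨j, hj⟩ := exists_eq_ciSup_of_finite (f := fun j => A j + u j)
  obtain ⟨k, hk⟩ := exists_eq_ciSup_of_finite (f := fun j => A j - u j)
  rw [← hj, ← hk]
  have h1 := le_iSup_of_finite (fun j => A j + v j) j
  have h2 := le_iSup_of_finite (fun j => A j + v j) k
  have h3 := le_iSup_of_finite (fun j => A j - v j) j
  have h4 := le_iSup_of_finite (fun j => A j - v j) k
  have h5 := le_abs_self (u j - u k)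
  have h6 := h j k
  rcases abs_cases (v j - v k) with h7 | h7 <;> linarith

/-- The Ledoux–Talagrand contraction principle for a finite family. The offset `A` carries the
coordinates that have already been treated in the induction on `n`. -/
theorem signAvg_iSup_contraction {n : ℕ} (A : J → ℝ) (u v : J → Fin n → ℝ)
    (h : ∀ j k i, |u j i - u k i| ≤ |v j i - v k i|) :
    signAvg n (fun ε => ⨆ j, (A j + ∑ i, boolSign (ε i) * u j i)) ≤
      signAvg n (fun ε => ⨆ j, (A j + ∑ i, boolSign (ε i) * v j i)) := by
  induction n generalizing A with
  | zero => simp [signAvg_zero]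
  | succ n ih =>
    simp only [signAvg_succ, sum_boolSign_cons_mul, ← add_assoc]
    have ih' (b : Bool) := ih (fun j => A j + boolSign b * u j 0) (fun j i => u j i.succ)
      (fun j i => v j i.succ) (fun j k i => h j k i.succ)
    have hstep : signAvg n (fun ε => ⨆ j, (A j + boolSign true * u j 0 +
          ∑ i, boolSign (ε i) * v j i.succ)) +
        signAvg n (fun ε => ⨆ j, (A j + boolSign false * u j 0 +
          ∑ i, boolSign (ε i) * v j i.succ)) ≤
        signAvg n (fun ε => ⨆ j, (A j + boolSign true * v j 0 +
          ∑ i, boolSign (ε i) * v j i.succ)) +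
        signAvg n (fun ε => ⨆ j, (A j + boolSign false * v j 0 +
          ∑ i, boolSign (ε i) * v j i.succ)) := by
      rw [← signAvg_add, ← signAvg_add]
      refine signAvg_mono fun ε => ?_
      have := iSup_add_add_iSup_sub_le (fun j => A j + ∑ i, boolSign (ε i) * v j i.succ)
        (fun j => u j 0) (fun j => v j 0) (fun j k => h j k 0)
      simpa [boolSign, add_right_comm, sub_eq_add_neg] using this
    linarith [ih' true, ih' false]

/-! ### The exponential moment of a maximum of sign sums -/

/-- A bounded-difference inequality on the cube `{±1} ^ n`, by induction on `n`: averaging over one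
sign costs a factor `cosh (l * c) ≤ exp (l ^ 2 * c ^ 2 / 2)`. -/
theorem signAvg_exp_iSup_le {n : ℕ} (A : J → ℝ) (g : J → Fin n → ℝ) {c : ℝ}
    (hg : ∀ j i, |g j i| ≤ c) (l : ℝ) :
    signAvg n (fun ε => Real.exp (l * ⨆ j, (A j + ∑ i, boolSign (ε i) * g j i))) ≤
      Real.exp (l * signAvg n (fun ε => ⨆ j, (A j + ∑ i, boolSign (ε i) * g j i)) +
        n * (l ^ 2 * c ^ 2 / 2)) := by
  induction n generalizing A with
  | zero => simp [signAvg_zero]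
  | succ n ih =>
    simp only [signAvg_succ, sum_boolSign_cons_mul, ← add_assoc]
    have ih' (b : Bool) := ih (fun j => A j + boolSign b * g j 0) (fun j i => g j i.succ)
      (fun j i => hg j i.succ)
    have hdiff (b b' : Bool) : signAvg n (fun ε => ⨆ j, (A j + boolSign b * g j 0 +
          ∑ i, boolSign (ε i) * g j i.succ)) ≤ signAvg n (fun ε => ⨆ j, (A j +
          boolSign b' * g j 0 + ∑ i, boolSign (ε i) * g j i.succ)) + 2 * c := by
      rw [← signAvg_const n (2 * c), ← signAvg_add]
      refine signAvg_mono fun ε => iSup_le_iSup_add _ _ fun j => ?_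
      have h := abs_le.1 (hg j 0)
      cases b <;> cases b' <;> simp [boolSign] <;> linarith
    have h1 := ih' true
    have h2 := ih' false
    have h3 := hdiff true false
    have h4 := hdiff false true
    set p := signAvg n (fun ε => ⨆ j, (A j + boolSign true * g j 0 +
      ∑ i, boolSign (ε i) * g j i.succ))
    set q := signAvg n (fun ε => ⨆ j, (A j + boolSign false * g j 0 +
      ∑ i, boolSign (ε i) * g j i.succ))
    refine (div_le_div_of_nonneg_right (add_le_add h1 h2) zero_le_two).trans ?_
    have hsq : (l * ((p - q) / 2)) ^ 2 ≤ l ^ 2 * c ^ 2 := by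
      rw [mul_pow]
      refine mul_le_mul_of_nonneg_left ?_ (sq_nonneg l)
      exact sq_le_sq' (by linarith) (by linarith)
    have hcosh : Real.cosh (l * ((p - q) / 2)) ≤ Real.exp (l ^ 2 * c ^ 2 / 2) :=
      (Real.cosh_le_exp_half_sq _).trans (Real.exp_le_exp.2 (by linarith))
    calc _ = Real.exp (l * ((p + q) / 2) + n * (l ^ 2 * c ^ 2 / 2)) *
          Real.cosh (l * ((p - q) / 2)) := by
          rw [show l * p = l * ((p + q) / 2) + l * ((p - q) / 2) by ring,
            show l * q = l * ((p + q) / 2) + -(l * ((p - q) / 2)) by ring, Real.cosh_eq]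
          simp only [Real.exp_add]
          ring
      _ ≤ _ := mul_le_mul_of_nonneg_left hcosh (Real.exp_pos _).le
      _ = _ := by
          rw [← Real.exp_add]
          push_cast
          ring_nf

end Finite

/-! ### Rademacher averages of linear classes -/

/-- Random signs are orthogonal: `E ‖a + ∑ εᵢ wᵢ‖ ^ 2 = ‖a‖ ^ 2 + ∑ ‖wᵢ‖ ^ 2`. The induction on `n`
uses this one sign at a time, in the form of the parallelogram law. -/
lemma signAvg_norm_le {E : Type*} [NormedAddCommGroup E] [InnerProductSpace ℝ E] {n : ℕ}
    (a : E) (w : Fin n → E) :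
    signAvg n (fun ε => ‖a + ∑ i, boolSign (ε i) • w i‖) ≤ √(‖a‖ ^ 2 + ∑ i, ‖w i‖ ^ 2) := by
  induction n generalizing a with
  | zero => simp [signAvg_zero]
  | succ n ih =>
    have hsum (b : Bool) (ε : Fin n → Bool) :
        a + ∑ i, boolSign ((Fin.cons b ε : Fin (n + 1) → Bool) i) • w i =
          (a + boolSign b • w 0) + ∑ i, boolSign (ε i) • w i.succ := by
      simp [Fin.sum_univ_succ, add_assoc]
    simp only [signAvg_succ, hsum]
    have h1 := ih (a + boolSign true • w 0) (fun i => w i.succ)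
    have h2 := ih (a + boolSign false • w 0) (fun i => w i.succ)
    have hpar := parallelogram_law_with_norm ℝ a (w 0)
    simp only [boolSign, if_true, Bool.false_eq_true, if_false, one_smul, neg_smul,
      ← sub_eq_add_neg] at h1 h2 ⊢
    rw [Fin.sum_univ_succ]
    set S := ∑ i : Fin n, ‖w i.succ‖ ^ 2
    have hS : 0 ≤ S := Finset.sum_nonneg fun i _ => sq_nonneg _
    have e1 := Real.sq_sqrt (add_nonneg (sq_nonneg ‖a + w 0‖) hS)
    have e2 := Real.sq_sqrt (add_nonneg (sq_nonneg ‖a - w 0‖) hS)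
    refine (div_le_div_of_nonneg_right (add_le_add h1 h2) zero_le_two).trans ?_
    apply Real.le_sqrt_of_sq_le
    nlinarith [sq_nonneg (√(‖a + w 0‖ ^ 2 + S) - √(‖a - w 0‖ ^ 2 + S))]

/-- The Rademacher average of a Lipschitz function of a linear class is at most
`L * r * ρ * √n`, whatever the dimension of the space. -/
theorem signAvg_iSup_lipschitz_inner_le {E : Type*} [NormedAddCommGroup E]
    [InnerProductSpace ℝ E] {J : Type*} [Finite J] [Nonempty J] {n : ℕ} {φ : ℝ → ℝ} {L : ℝ}
    (hL : 0 ≤ L) (hφ : ∀ s t, |φ s - φ t| ≤ L * |s - t|) {r ρ : ℝ} (hr : 0 ≤ r) (hρ : 0 ≤ ρ)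
    (θ : J → E) (hθ : ∀ j, ‖θ j‖ ≤ r) (w : Fin n → E) (hw : ∀ i, ‖w i‖ ≤ ρ) :
    signAvg n (fun ε => ⨆ j, ∑ i, boolSign (ε i) * φ (inner ℝ (θ j) (w i))) ≤
      L * r * ρ * √n := by
  have h1 := signAvg_iSup_contraction (fun _ : J => 0)
    (fun j i => φ (inner ℝ (θ j) (w i))) (fun j i => L * inner ℝ (θ j) (w i))
    (fun j k i => by rw [← mul_sub, abs_mul, abs_of_nonneg hL]; exact hφ _ _)
  simp only [zero_add] at h1
  refine h1.trans ?_
  have h2 (ε : Fin n → Bool) : ⨆ j, ∑ i, boolSign (ε i) * (L * inner ℝ (θ j) (w i)) ≤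
      L * r * ‖0 + ∑ i, boolSign (ε i) • w i‖ := by
    refine ciSup_le fun j => ?_
    have : ∑ i, boolSign (ε i) * (L * inner ℝ (θ j) (w i)) =
        L * inner ℝ (θ j) (0 + ∑ i, boolSign (ε i) • w i) := by
      rw [zero_add, inner_sum, Finset.mul_sum]
      refine Finset.sum_congr rfl fun i _ => ?_
      rw [real_inner_smul_right]
      ring
    rw [this, mul_assoc]
    gcongr
    exact (real_inner_le_norm _ _).trans (by gcongr; exact hθ j)
  refine (signAvg_mono h2).trans ?_
  rw [signAvg_mul_left, mul_assoc (L * r)]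
  refine mul_le_mul_of_nonneg_left ((signAvg_norm_le 0 w).trans ?_) (mul_nonneg hL hr)
  rw [Real.sqrt_le_left (by positivity), mul_pow, Real.sq_sqrt (Nat.cast_nonneg n)]
  calc ‖(0 : E)‖ ^ 2 + ∑ i, ‖w i‖ ^ 2 ≤ 0 + ∑ _i : Fin n, ρ ^ 2 := by
        simp only [norm_zero]
        gcongr with i
        · simp
        · exact hw i
    _ = ρ ^ 2 * n := by simp [mul_comm]

/-! ### Symmetrization -/

/-- Exchanging `zᵢ` and `z'ᵢ` for any set of indices preserves the law of the pair of samples, so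
random signs may be inserted. -/
lemma integral_exp_iSup_boolSign {Z : Type*} [MeasurableSpace Z] {J : Type*} {n : ℕ}
    (P : Measure Z) [IsProbabilityMeasure P] (F : J → Z → ℝ) (l : ℝ) (ε : Fin n → Bool) :
    ∫ p, Real.exp (l * ⨆ j, ∑ i, boolSign (ε i) * (F j (p i).2 - F j (p i).1))
        ∂Measure.pi (fun _ : Fin n => P.prod P) =
      ∫ p, Real.exp (l * ⨆ j, ∑ i, (F j (p i).2 - F j (p i).1))
        ∂Measure.pi (fun _ : Fin n => P.prod P) := by
  -- The sign `-1`, encoded by `false`, exchanges the two points of a pair.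
  let e (b : Bool) : Z × Z ≃ᵐ Z × Z :=
    if b then MeasurableEquiv.refl _ else MeasurableEquiv.prodComm
  have he (b : Bool) : MeasurePreserving (e b) (P.prod P) (P.prod P) := by
    cases b
    · exact Measure.measurePreserving_swap
    · exact MeasurePreserving.id _
  have hT : MeasurePreserving (MeasurableEquiv.piCongrRight fun i => e (ε i))
      (Measure.pi fun _ : Fin n => P.prod P) (Measure.pi fun _ : Fin n => P.prod P) :=
    measurePreserving_pi _ _ fun i => he (ε i)
  rw [← hT.integral_comp' fun p : Fin n → Z × Z =>
    Real.exp (l * ⨆ j, ∑ i, (F j (p i).2 - F j (p i).1))]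
  congr! 7 with p j i
  change _ = F j (e (ε i) (p i)).2 - F j (e (ε i) (p i)).1
  cases ε i
  · simp [e, boolSign, MeasurableEquiv.prodComm]
  · simp [e, boolSign]

section Symmetrization

variable {Z : Type*} [MeasurableSpace Z] {J : Type*} [Finite J] [Nonempty J] {n : ℕ}

lemma integrable_of_measurable_of_abs_le {Ω : Type*} [MeasurableSpace Ω] (ν : Measure Ω)
    [IsProbabilityMeasure ν] {g : Ω → ℝ} (hg : Measurable g) {c : ℝ} (hc : ∀ x, |g x| ≤ c) :
    Integrable g ν :=
  Integrable.of_bound hg.aestronglyMeasurable c (.of_forall hc)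

lemma abs_iSup_sum_le (g : J → Fin n → ℝ) {c : ℝ} (hg : ∀ j i, |g j i| ≤ c) :
    |⨆ j, ∑ i, g j i| ≤ n * c := by
  obtain ⟨j, hj⟩ := exists_eq_ciSup_of_finite (f := fun j => ∑ i, g j i)
  rw [← hj]
  calc |∑ i, g j i| ≤ ∑ i, |g j i| := Finset.abs_sum_le_sum_abs _ _
    _ ≤ ∑ _i : Fin n, c := Finset.sum_le_sum fun i _ => hg j i
    _ = n * c := by simp

/-- The exponential of a maximum of bounded measurable sums is integrable. -/
lemma integrable_exp_iSup_sum {Ω : Type*} [MeasurableSpace Ω] (ν : Measure Ω)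
    [IsProbabilityMeasure ν] (g : J → Fin n → Ω → ℝ) (hg : ∀ j i, Measurable (g j i)) {c : ℝ}
    (hc : ∀ j i x, |g j i x| ≤ c) (l : ℝ) :
    Integrable (fun x => Real.exp (l * ⨆ j, ∑ i, g j i x)) ν := by
  refine integrable_of_measurable_of_abs_le ν (c := Real.exp (|l| * (n * c))) ?_ fun x => ?_
  · have : Measurable fun x => ⨆ j, ∑ i, g j i x :=
      Measurable.iSup fun j => Finset.measurable_fun_sum _ fun i _ => hg j i
    fun_prop
  · rw [Real.abs_exp, Real.exp_le_exp]
    refine (le_abs_self _).trans ?_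
    rw [abs_mul]
    gcongr
    exact abs_iSup_sum_le _ fun j i => hc j i x

variable (P : Measure Z) [IsProbabilityMeasure P] {f : J → Z → ℝ}

lemma abs_integral_sub_le {g : Z → ℝ} (hg : Measurable g) {D : ℝ}
    (hD : ∀ z, g z ∈ Set.Icc 0 D) (z : Z) : |∫ x, g x ∂P - g z| ≤ D := by
  have h0 : 0 ≤ ∫ x, g x ∂P := integral_nonneg fun x => (hD x).1
  have h1 : ∫ x, g x ∂P ≤ ∫ _x, D ∂P :=
    integral_mono (integrable_of_measurable_of_abs_le P hg fun x =>
      (abs_of_nonneg (hD x).1).le.trans (hD x).2) (integrable_const _) fun x => (hD x).2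
  simp only [integral_const, probReal_univ, one_smul] at h1
  exact abs_sub_le_iff.2 ⟨by linarith [(hD z).1], by linarith [(hD z).2]⟩

lemma integrable_exp_iSup_deviation (hf : ∀ j, Measurable (f j)) {D : ℝ}
    (hD : ∀ j z, f j z ∈ Set.Icc 0 D) (l : ℝ) :
    Integrable (fun z : Fin n → Z => Real.exp (l * ⨆ j, ∑ i, (∫ x, f j x ∂P - f j (z i))))
      (Measure.pi fun _ : Fin n => P) := by
  have h1 (j : J) (i : Fin n) : Measurable fun z : Fin n → Z => ∫ x, f j x ∂P - f j (z i) :=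
    ((hf j).comp (measurable_pi_apply i)).const_sub _
  have h2 (j : J) (i : Fin n) (z : Fin n → Z) : |∫ x, f j x ∂P - f j (z i)| ≤ D :=
    abs_integral_sub_le P (hf j) (hD j) _
  have := integrable_exp_iSup_sum (Measure.pi fun _ : Fin n => P)
    (fun j i (z : Fin n → Z) => ∫ x, f j x ∂P - f j (z i)) h1 h2 l
  exact this

/-- Jensen's inequality for the ghost sample `z'`: expectations may be replaced by the averages
over an independent copy of the sample. -/
lemma exp_iSup_sum_integral_sub_le (hf : ∀ j, Measurable (f j)) {D : ℝ}
    (hD : ∀ j z, f j z ∈ Set.Icc 0 D) {l : ℝ} (hl : 0 ≤ l) (z : Fin n → Z) :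
    Real.exp (l * ⨆ j, ∑ i, (∫ x, f j x ∂P - f j (z i))) ≤
      ∫ z', Real.exp (l * ⨆ j, ∑ i, (f j (z' i) - f j (z i))) ∂Measure.pi fun _ : Fin n => P := by
  set ν := Measure.pi fun _ : Fin n => P
  have habs (j : J) (x y : Z) : |f j x - f j y| ≤ D :=
    abs_sub_le_iff.2 ⟨by linarith [(hD j x).2, (hD j y).1], by linarith [(hD j x).1, (hD j y).2]⟩
  have hint : Integrable (fun z' : Fin n → Z =>
      Real.exp (l * ⨆ j, ∑ i, (f j (z' i) - f j (z i)))) ν :=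
    integrable_exp_iSup_sum ν (fun j i z' => f j (z' i) - f j (z i))
      (fun j i => by have := hf j; fun_prop) (fun j i z' => habs j _ _) l
  obtain ⟨j, hj⟩ := exists_eq_ciSup_of_finite (f := fun j => ∑ i, (∫ x, f j x ∂P - f j (z i)))
  rw [← hj]
  have hterm (i : Fin n) : Integrable (fun z' : Fin n → Z => f j (z' i) - f j (z i)) ν :=
    integrable_of_measurable_of_abs_le ν (by have := hf j; fun_prop) fun z' => habs j _ _
  have hev (i : Fin n) : Integrable (fun z' : Fin n → Z => f j (z' i)) ν :=
    integrable_of_measurable_of_abs_le ν (c := D) (by have := hf j; fun_prop) fun z' =>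
      (abs_of_nonneg (hD j _).1).le.trans (hD j _).2
  have hmean : l * ∑ i, (∫ x, f j x ∂P - f j (z i)) =
      ∫ z', l * ∑ i, (f j (z' i) - f j (z i)) ∂ν := by
    rw [integral_const_mul, integral_finsetSum _ fun i _ => hterm i]
    congr 1
    refine Finset.sum_congr rfl fun i _ => ?_
    rw [integral_sub (hev i) (integrable_const _), integral_const, probReal_univ, one_smul,
      integral_comp_eval (hf j).aestronglyMeasurable]
  have hexp : Integrable (fun z' : Fin n → Z =>
      Real.exp (l * ∑ i, (f j (z' i) - f j (z i)))) ν := by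
    have := integrable_exp_iSup_sum (J := Unit) ν (fun _ i z' => f j (z' i) - f j (z i))
      (fun _ i => by have := hf j; fun_prop) (fun _ i z' => habs j _ _) l
    simpa using this
  rw [hmean]
  refine (convexOn_exp.map_integral_le Real.continuous_exp.continuousOn isClosed_univ
    (by simp) ((integrable_finsetSum _ fun i _ => hterm i).const_mul l) hexp).trans ?_
  refine integral_mono hexp hint fun z' => ?_
  gcongr
  exact le_iSup_of_finite (fun j => ∑ i, (f j (z' i) - f j (z i))) j

/-- The exponential moment of the largest deviation over a finite family, given a bound `K` on its
Rademacher averages: after symmetrization it is an exponential moment over random signs only, and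
`signAvg_exp_iSup_le` applies to each pair of samples. -/
theorem integral_exp_iSup_le (hf : ∀ j, Measurable (f j)) {D : ℝ}
    (hD : ∀ j z, f j z ∈ Set.Icc 0 D) {K : ℝ}
    (hK : ∀ z : Fin n → Z, signAvg n (fun ε => ⨆ j, ∑ i, boolSign (ε i) * f j (z i)) ≤ K)
    {l : ℝ} (hl : 0 ≤ l) :
    ∫ z, Real.exp (l * ⨆ j, ∑ i, (∫ x, f j x ∂P - f j (z i))) ∂Measure.pi (fun _ : Fin n => P) ≤
      Real.exp (l * (2 * K) + n * (l ^ 2 * D ^ 2 / 2)) := by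
  set ν := Measure.pi fun _ : Fin n => P
  have habs {x y : ℝ} (hx : x ∈ Set.Icc 0 D) (hy : y ∈ Set.Icc 0 D) : |x - y| ≤ D :=
    abs_sub_le_iff.2 ⟨by linarith [hx.2, hy.1], by linarith [hx.1, hy.2]⟩
  have hprod : Integrable (fun q : (Fin n → Z) × (Fin n → Z) =>
      Real.exp (l * ⨆ j, ∑ i, (f j (q.2 i) - f j (q.1 i)))) (ν.prod ν) :=
    integrable_exp_iSup_sum (ν.prod ν)
      (fun j i (q : (Fin n → Z) × (Fin n → Z)) => f j (q.2 i) - f j (q.1 i))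
      (fun j i => by have := hf j; fun_prop) (fun j i q => habs (hD j _) (hD j _)) l
  have hsign (ε : Fin n → Bool) : Integrable (fun p : Fin n → Z × Z =>
      Real.exp (l * ⨆ j, ∑ i, boolSign (ε i) * (f j (p i).2 - f j (p i).1)))
      (Measure.pi fun _ : Fin n => P.prod P) :=
    integrable_exp_iSup_sum (Measure.pi fun _ : Fin n => P.prod P)
      (fun j i (p : Fin n → Z × Z) => boolSign (ε i) * (f j (p i).2 - f j (p i).1))
      (fun j i => by have := hf j; fun_prop)
      (fun j i p => by rw [abs_mul, abs_boolSign, one_mul]; exact habs (hD j _) (hD j _)) l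
  -- For a fixed pair of samples, split the maximum of the differences into two maxima.
  have hmean (p : Fin n → Z × Z) : signAvg n (fun ε => ⨆ j, ∑ i, boolSign (ε i) *
      (f j (p i).2 - f j (p i).1)) ≤ 2 * K := by
    have h1 := hK fun i => (p i).2
    have h2 := hK fun i => (p i).1
    rw [← signAvg_comp_not] at h2
    rw [two_mul]
    refine le_trans ?_ (add_le_add h1 h2)
    rw [← signAvg_add]
    refine signAvg_mono fun ε => ciSup_le fun j => ?_
    refine le_trans (le_of_eq ?_) (add_le_add
      (le_iSup_of_finite (fun j => ∑ i, boolSign (ε i) * f j (p i).2) j)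
      (le_iSup_of_finite (fun j => ∑ i, boolSign (!ε i) * f j (p i).1) j))
    rw [← Finset.sum_add_distrib]
    refine Finset.sum_congr rfl fun i _ => ?_
    rw [boolSign_not]
    ring

  calc ∫ z, Real.exp (l * ⨆ j, ∑ i, (∫ x, f j x ∂P - f j (z i))) ∂ν
      ≤ ∫ z, ∫ z', Real.exp (l * ⨆ j, ∑ i, (f j (z' i) - f j (z i))) ∂ν ∂ν :=
        integral_mono
          (integrable_exp_iSup_deviation P hf hD l)
          hprod.integral_prod_left fun z => exp_iSup_sum_integral_sub_le P hf hD hl z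
    _ = ∫ q, Real.exp (l * ⨆ j, ∑ i, (f j (q.2 i) - f j (q.1 i))) ∂ν.prod ν :=
        (integral_prod _ hprod).symm
    _ = ∫ p, Real.exp (l * ⨆ j, ∑ i, (f j (p i).2 - f j (p i).1))
          ∂Measure.pi (fun _ : Fin n => P.prod P) :=
        ((measurePreserving_arrowProdEquivProdArrow Z Z (Fin n) (fun _ => P)
          (fun _ => P)).integral_comp' fun q : (Fin n → Z) × (Fin n → Z) =>
            Real.exp (l * ⨆ j, ∑ i, (f j (q.2 i) - f j (q.1 i)))).symm
    _ = signAvg n (fun ε => ∫ p, Real.exp (l * ⨆ j, ∑ i, boolSign (ε i) *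
          (f j (p i).2 - f j (p i).1)) ∂Measure.pi (fun _ : Fin n => P.prod P)) := by
        simp only [integral_exp_iSup_boolSign, signAvg_const]
    _ = ∫ p, signAvg n (fun ε => Real.exp (l * ⨆ j, ∑ i, boolSign (ε i) *
          (f j (p i).2 - f j (p i).1))) ∂Measure.pi (fun _ : Fin n => P.prod P) := by
        unfold signAvg
        rw [integral_div, integral_finsetSum _ fun ε _ => hsign ε]
    _ ≤ ∫ _p, Real.exp (l * (2 * K) + n * (l ^ 2 * D ^ 2 / 2))
          ∂Measure.pi (fun _ : Fin n => P.prod P) := by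
        refine integral_mono ?_ (integrable_const _) fun p => ?_
        · exact (integrable_finsetSum _ fun ε _ => hsign ε).div_const _
        · have h := signAvg_exp_iSup_le (fun _ : J => 0)
            (fun j i => f j (p i).2 - f j (p i).1) (fun j i => habs (hD j _) (hD j _)) l
          simp only [zero_add] at h
          refine h.trans (Real.exp_le_exp.2 ?_)
          gcongr
          exact hmean p
    _ = _ := by simp

/-- Chernoff's bound, at the optimal parameter `l = s / (n * D ^ 2)`. -/
theorem measureReal_le_iSup_le (hn : 0 < n) (hf : ∀ j, Measurable (f j)) {D : ℝ} (hD0 : 0 < D)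
    (hD : ∀ j z, f j z ∈ Set.Icc 0 D) {K : ℝ}
    (hK : ∀ z : Fin n → Z, signAvg n (fun ε => ⨆ j, ∑ i, boolSign (ε i) * f j (z i)) ≤ K)
    {s : ℝ} (hs : 0 ≤ s) :
    (Measure.pi fun _ : Fin n => P).real
        {z | 2 * K + s ≤ ⨆ j, ∑ i, (∫ x, f j x ∂P - f j (z i))} ≤
      Real.exp (-(s ^ 2 / (2 * n * D ^ 2))) := by
  have hn' : (0 : ℝ) < n := by exact_mod_cast hn
  have hl : 0 ≤ s / (n * D ^ 2) := by positivity
  have h := measure_ge_le_exp_mul_mgf (μ := Measure.pi fun _ : Fin n => P)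
    (X := fun z => ⨆ j, ∑ i, (∫ x, f j x ∂P - f j (z i))) (2 * K + s) hl
    (integrable_exp_iSup_deviation P hf hD _)
  refine h.trans ((mul_le_mul_of_nonneg_left (integral_exp_iSup_le P hf hD hK hl)
    (Real.exp_pos _).le).trans (le_of_eq ?_))
  rw [← Real.exp_add]
  congr 1
  field_simp
  ring

end Symmetrization

/-! ### The loss as a function of the margin -/

/-- With `1 / ∞ = 0` all three branches of the loss have the derivative `- p ^ (-1 / α)`. -/
lemma hasDerivAt_probLoss {α : ℝ≥0∞} (hα : 0 < α) {p : ℝ} (hp : 0 < p) :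
    HasDerivAt (probLoss α) (-p ^ (-(1 / α.toReal))) p := by
  by_cases h1 : α = ⊤
  · have : probLoss α = fun p => 1 - p := by ext; simp [probLoss, h1]
    rw [this]
    simpa [h1] using (hasDerivAt_id p).const_sub 1
  by_cases h2 : α = 1
  · have : probLoss α = fun p => -Real.log p := by ext; simp [probLoss, h2]
    rw [this]
    have := (Real.hasDerivAt_log hp.ne').fun_neg
    simpa [h2, Real.rpow_neg_one] using this
  have h : probLoss α = fun p => α.toReal / (α.toReal - 1) * (1 - p ^ (1 - 1 / α.toReal)) := by
    ext; simp [probLoss, h1, h2]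
  have ha : 0 < α.toReal := ENNReal.toReal_pos hα.ne' h1
  have ha1 : α.toReal - 1 ≠ 0 := by
    rw [sub_ne_zero]
    intro h
    exact h2 ((ENNReal.toReal_eq_one_iff α).1 h)
  rw [h]
  convert! ((Real.hasDerivAt_rpow_const (p := 1 - 1 / α.toReal) (Or.inl hp.ne')).const_sub
    1).const_mul (α.toReal / (α.toReal - 1)) using 1
  rw [show 1 - 1 / α.toReal - 1 = -(1 / α.toReal) by ring]
  field_simp

lemma probLoss_one (α : ℝ≥0∞) : probLoss α 1 = 0 := by
  simp [probLoss]

lemma strictAntiOn_probLoss {α : ℝ≥0∞} (hα : 0 < α) :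
    StrictAntiOn (probLoss α) (Set.Ioi 0) := by
  refine strictAntiOn_of_deriv_neg (convex_Ioi 0)
    (fun p hp => (hasDerivAt_probLoss hα hp).continuousAt.continuousWithinAt) fun p hp => ?_
  rw [interior_Ioi] at hp
  rw [(hasDerivAt_probLoss hα hp).deriv]
  exact neg_lt_zero.2 (Real.rpow_pos_of_pos hp _)

lemma boundConst_eq (r₀ : ℝ) (α : ℝ≥0∞) : boundConst r₀ α = probLoss α (Real.sigmoid (-r₀)) := rfl

lemma probLoss_sigmoid_pos {α : ℝ≥0∞} (hα : 0 < α) (t : ℝ) : 0 < probLoss α (Real.sigmoid t) := by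
  rw [← probLoss_one α]
  exact strictAntiOn_probLoss hα (Real.sigmoid_pos t) (Set.mem_Ioi.2 one_pos)
    (Real.sigmoid_lt_one t)

lemma probLoss_sigmoid_le_boundConst {α : ℝ≥0∞} (hα : 0 < α) {r₀ t : ℝ} (ht : -r₀ ≤ t) :
    probLoss α (Real.sigmoid t) ≤ boundConst r₀ α := by
  rw [boundConst_eq]
  exact (strictAntiOn_probLoss hα).antitoneOn (Real.sigmoid_pos _) (Real.sigmoid_pos t)
    (Real.sigmoid_le ht)

lemma hasDerivAt_probLoss_sigmoid {α : ℝ≥0∞} (hα : 0 < α) (t : ℝ) :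
    HasDerivAt (fun t => probLoss α (Real.sigmoid t))
      (-(Real.sigmoid t ^ (1 - 1 / α.toReal) * (1 - Real.sigmoid t))) t := by
  have hs := Real.sigmoid_pos t
  convert! (hasDerivAt_probLoss hα hs).comp t (Real.hasDerivAt_sigmoid t) using 1
  rw [sub_eq_neg_add 1 (1 / α.toReal), Real.rpow_add hs, Real.rpow_one]
  ring

/-- On `(0, 1)` the function `p ^ b * (1 - p)` has its maximum at `p = b / (1 + b)`. Taking
logarithms, this is two instances of `log x ≤ x - 1`. -/
lemma rpow_mul_one_sub_le {b p : ℝ} (hb : 0 < b) (hp : 0 < p) (hp1 : p < 1) :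
    p ^ b * (1 - p) ≤ (b / (1 + b)) ^ b * (1 / (1 + b)) := by
  have hq : 0 < 1 - p := by linarith
  have hb1 : 0 < 1 + b := by linarith
  have h1 := Real.log_le_sub_one_of_pos (x := p / (b / (1 + b))) (by positivity)
  have h2 := Real.log_le_sub_one_of_pos (x := (1 - p) / (1 / (1 + b))) (by positivity)
  have h3 : Real.log (p ^ b * (1 - p)) ≤ Real.log ((b / (1 + b)) ^ b * (1 / (1 + b))) := by
    rw [Real.log_mul (by positivity) hq.ne', Real.log_mul (by positivity) (by positivity),
      Real.log_rpow hp, Real.log_rpow (by positivity)]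
    rw [Real.log_div hp.ne' (by positivity)] at h1
    rw [Real.log_div hq.ne' (by positivity)] at h2
    have h4 := mul_le_mul_of_nonneg_left h1 hb.le
    have h5 : b * (p / (b / (1 + b)) - 1) + ((1 - p) / (1 / (1 + b)) - 1) = 0 := by
      field_simp
      ring
    linarith
  exact (Real.log_le_log_iff (by positivity) (by positivity)).1 h3

lemma rpow_mul_one_sub_sigmoid_le_lipConst {α : ℝ≥0∞} (hα : 0 < α) {r₀ t : ℝ} (ht : |t| ≤ r₀) :
    Real.sigmoid t ^ (1 - 1 / α.toReal) * (1 - Real.sigmoid t) ≤ lipConst r₀ α := by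
  obtain ⟨ht1, ht2⟩ := abs_le.1 ht
  have hs := Real.sigmoid_pos t
  have hs1 := Real.sigmoid_lt_one t
  unfold lipConst
  split_ifs with h1 h2
  · simp only [h1, ENNReal.toReal_top, div_zero, sub_zero, Real.rpow_one]
    nlinarith [sq_nonneg (Real.sigmoid t - 1 / 2)]
  · have ha : 0 < α.toReal := ENNReal.toReal_pos hα.ne' h1
    have ha1 : α.toReal ≤ 1 := by simpa using ENNReal.toReal_mono ENNReal.one_ne_top h2
    rw [← Real.sigmoid_neg, mul_comm]
    refine mul_le_mul (Real.sigmoid_le (by linarith)) ?_ (Real.rpow_nonneg hs.le _)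
      (Real.sigmoid_nonneg _)
    refine Real.rpow_le_rpow_of_nonpos (Real.sigmoid_pos _) (Real.sigmoid_le ht1) ?_
    rw [sub_nonpos, le_div_iff₀ ha]
    linarith
  · have ha : 1 < α.toReal := by
      rw [← ENNReal.toReal_one]
      exact (ENNReal.toReal_lt_toReal ENNReal.one_ne_top h1).2 (not_le.1 h2)
    have hb : 0 < 1 - 1 / α.toReal := by
      rw [sub_pos, div_lt_one (by linarith)]
      exact ha
    have := rpow_mul_one_sub_le hb hs hs1
    have h0 : α.toReal ≠ 0 := by linarith
    have h2a : 2 * α.toReal - 1 ≠ 0 := by linarith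
    have e : 1 + (1 - 1 / α.toReal) = (2 * α.toReal - 1) / α.toReal := by
      field_simp
      ring
    rw [e] at this
    convert this using 2
    · congr 1
      field_simp
    · field_simp

lemma lipConst_nonneg {r₀ : ℝ} (hr₀ : 0 ≤ r₀) {α : ℝ≥0∞} (hα : 0 < α) : 0 ≤ lipConst r₀ α :=
  (mul_nonneg (Real.rpow_nonneg (Real.sigmoid_nonneg 0) _)
    (sub_nonneg.2 (Real.sigmoid_le_one 0))).trans
      (rpow_mul_one_sub_sigmoid_le_lipConst hα (by simpa using hr₀))

lemma abs_probLoss_sigmoid_sub_le {α : ℝ≥0∞} (hα : 0 < α) {r₀ s t : ℝ}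
    (hs : s ∈ Set.Icc (-r₀) r₀) (ht : t ∈ Set.Icc (-r₀) r₀) :
    |probLoss α (Real.sigmoid s) - probLoss α (Real.sigmoid t)| ≤ lipConst r₀ α * |s - t| := by
  refine (convex_Icc (-r₀) r₀).norm_image_sub_le_of_norm_hasDerivWithin_le
    (fun x _ => (hasDerivAt_probLoss_sigmoid hα x).hasDerivWithinAt) (fun x hx => ?_) ht hs
  rw [norm_neg, Real.norm_of_nonneg]
  · exact rpow_mul_one_sub_sigmoid_le_lipConst hα (abs_le.2 hx)
  · exact mul_nonneg (Real.rpow_nonneg (Real.sigmoid_nonneg x) _)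
      (sub_nonneg.2 (Real.sigmoid_le_one x))

/-- The loss as a function of the margin `t = ⟨θ, y x⟩`, with the margin clamped to `[-r₀, r₀]`.
Clamping makes it bounded and Lipschitz on all of `ℝ`, and changes nothing at the margins that
occur almost surely. -/
noncomputable def clampedLoss (α : ℝ≥0∞) (r₀ t : ℝ) : ℝ :=
  probLoss α (Real.sigmoid (max (-r₀) (min r₀ t)))

lemma clamp_mem_Icc {r₀ : ℝ} (hr₀ : 0 ≤ r₀) (t : ℝ) :
    max (-r₀) (min r₀ t) ∈ Set.Icc (-r₀) r₀ :=
  ⟨le_max_left _ _, max_le (by linarith) (min_le_left _ _)⟩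

lemma clampedLoss_eq {α : ℝ≥0∞} {r₀ t : ℝ} (ht : |t| ≤ r₀) :
    clampedLoss α r₀ t = probLoss α (Real.sigmoid t) := by
  obtain ⟨h1, h2⟩ := abs_le.1 ht
  rw [clampedLoss, min_eq_right h2, max_eq_right h1]

lemma clampedLoss_mem_Icc {α : ℝ≥0∞} (hα : 0 < α) (r₀ t : ℝ) :
    clampedLoss α r₀ t ∈ Set.Icc 0 (boundConst r₀ α) :=
  ⟨(probLoss_sigmoid_pos hα _).le, probLoss_sigmoid_le_boundConst hα (le_max_left _ _)⟩

lemma abs_clampedLoss_sub_le {α : ℝ≥0∞} (hα : 0 < α) {r₀ : ℝ} (hr₀ : 0 ≤ r₀) (s t : ℝ) :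
    |clampedLoss α r₀ s - clampedLoss α r₀ t| ≤ lipConst r₀ α * |s - t| := by
  refine (abs_probLoss_sigmoid_sub_le hα (clamp_mem_Icc hr₀ s) (clamp_mem_Icc hr₀ t)).trans ?_
  refine mul_le_mul_of_nonneg_left ?_ (lipConst_nonneg hr₀ hα)
  refine (abs_max_sub_max_le_max _ _ _ _).trans ?_
  simp only [sub_self, abs_zero]
  refine max_le (abs_nonneg _) ((abs_min_sub_min_le_max _ _ _ _).trans ?_)
  simp

/-! ### Uniform deviation over a ball of linear predictors -/

section Ball

variable {E : Type*} [NormedAddCommGroup E] [InnerProductSpace ℝ E] {Z : Type*}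
  [MeasurableSpace Z]

/-- The expectation of `φ ⟨θ, w z⟩` minus its average over the sample `z`. -/
noncomputable def deviation (P : Measure Z) (φ : ℝ → ℝ) (w : Z → E) {n : ℕ} (z : Fin n → Z)
    (θ : E) : ℝ :=
  ∫ x, φ (inner ℝ θ (w x)) ∂P - 1 / (n : ℝ) * ∑ i, φ (inner ℝ θ (w (z i)))

variable (P : Measure Z) {φ : ℝ → ℝ} {w : Z → E} {n : ℕ}

lemma sum_integral_sub_eq_mul_deviation (hn : 0 < n) (z : Fin n → Z) (θ : E) :
    ∑ i, (∫ x, φ (inner ℝ θ (w x)) ∂P - φ (inner ℝ θ (w (z i)))) = n * deviation P φ w z θ := by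
  have : (n : ℝ) ≠ 0 := by exact_mod_cast hn.ne'
  rw [deviation, Finset.sum_sub_distrib]
  simp only [Finset.sum_const, Finset.card_univ, Fintype.card_fin, nsmul_eq_mul]
  field_simp

variable [IsProbabilityMeasure P] [MeasurableSpace E] [BorelSpace E] [SecondCountableTopology E]

lemma continuous_deviation (hφ : Continuous φ) {D : ℝ} (hD : ∀ t, φ t ∈ Set.Icc 0 D)
    (hw : Measurable w) (z : Fin n → Z) : Continuous (deviation P φ w z) := by
  refine Continuous.sub ?_ (by fun_prop)
  refine continuous_of_dominated (bound := fun _ => D) (fun θ => ?_) (fun θ => ?_)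
    (integrable_const _) (.of_forall fun x => by fun_prop)
  · exact (hφ.measurable.comp (measurable_const.inner hw)).aestronglyMeasurable
  · exact .of_forall fun x => (abs_of_nonneg (hD _).1).le.trans (hD _).2

/-- The one-sided bound for a finite family. The exponent `16 * log (4 / δ)` that comes out of
Chernoff's bound is larger than needed, hence only `log (4 / δ)` is kept. -/
lemma measure_exists_deviation_gt_le_of_finite {J : Type*} [Finite J] [Nonempty J] (hn : 0 < n)
    {L D r ρ δ : ℝ} (hL : 0 ≤ L) (hφ : ∀ s t, |φ s - φ t| ≤ L * |s - t|) (hD0 : 0 < D)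
    (hD : ∀ t, φ t ∈ Set.Icc 0 D) (hr : 0 ≤ r) (hρ : 0 ≤ ρ) (hw : Measurable w)
    (hwρ : ∀ x, ‖w x‖ ≤ ρ) (hδ₀ : 0 < δ) (hδ₁ : δ < 1) (θ : J → E) (hθ : ∀ j, ‖θ j‖ ≤ r) :
    (Measure.pi fun _ : Fin n => P) {z | ∃ j, L * (2 * r * ρ / √n) +
        4 * D * √(2 * Real.log (4 / δ) / n) < deviation P φ w z (θ j)} ≤
      ENNReal.ofReal (δ / 4) := by
  have hn' : (0 : ℝ) < n := by exact_mod_cast hn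
  have hφc : Continuous φ :=
    (LipschitzWith.of_dist_le_mul (K := ⟨L, hL⟩) fun s t => hφ s t).continuous
  have hlog : 0 ≤ Real.log (4 / δ) :=
    Real.log_nonneg (by rw [le_div_iff₀ hδ₀]; linarith)
  have h := measureReal_le_iSup_le (n := n) P hn (f := fun j x => φ (inner ℝ (θ j) (w x)))
    (fun j => hφc.measurable.comp (measurable_const.inner hw)) hD0 (fun j x => hD _)
    (fun z => signAvg_iSup_lipschitz_inner_le hL hφ hr hρ θ hθ (fun i => w (z i))
      fun i => hwρ _) (s := n * (4 * D * √(2 * Real.log (4 / δ) / n))) (by positivity)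
  have hexp : Real.exp (-((n * (4 * D * √(2 * Real.log (4 / δ) / n))) ^ 2 / (2 * n * D ^ 2))) ≤
      δ / 4 := by
    rw [mul_pow, mul_pow, Real.sq_sqrt (by positivity)]
    calc _ = Real.exp (-(16 * Real.log (4 / δ))) := by
          congr 2
          field_simp
          ring
      _ ≤ Real.exp (-Real.log (4 / δ)) := Real.exp_le_exp.2 (by linarith)
      _ = δ / 4 := by rw [Real.exp_neg, Real.exp_log (by positivity), inv_div]
  refine (measure_mono ?_).trans ((ENNReal.le_ofReal_iff_toReal_le (measure_ne_top _ _)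
    (by positivity)).2 (h.trans hexp))
  rintro z ⟨j, hj⟩
  refine le_trans ?_ (le_iSup_of_finite (fun j => ∑ i, (∫ x, φ (inner ℝ (θ j) (w x)) ∂P -
    φ (inner ℝ (θ j) (w (z i))))) j)
  rw [sum_integral_sub_eq_mul_deviation P hn]
  refine le_trans (le_of_eq ?_) (mul_le_mul_of_nonneg_left hj.le hn'.le)
  have hs : (n : ℝ) / √n = √n := Real.div_sqrt
  rw [mul_add]
  congr 1
  calc 2 * (L * r * ρ * √n) = 2 * (L * r * ρ * (n / √n)) := by rw [hs]
    _ = n * (L * (2 * r * ρ / √n)) := by ring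

lemma deviation_const_sub (hn : 0 < n) (hφ : Continuous φ) {D : ℝ} (hD : ∀ t, φ t ∈ Set.Icc 0 D)
    (hw : Measurable w) (z : Fin n → Z) (θ : E) :
    deviation P (fun t => D - φ t) w z θ = -deviation P φ w z θ := by
  have hint : Integrable (fun x => φ (inner ℝ θ (w x))) P :=
    integrable_of_measurable_of_abs_le P (hφ.measurable.comp (measurable_const.inner hw))
      fun x => (abs_of_nonneg (hD _).1).le.trans (hD _).2
  have : (n : ℝ) ≠ 0 := by exact_mod_cast hn.ne'
  simp only [deviation, integral_sub (integrable_const D) hint, integral_const, probReal_univ,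
    one_smul, Finset.sum_sub_distrib, Finset.sum_const, Finset.card_univ, Fintype.card_fin,
    nsmul_eq_mul]
  field_simp
  ring

/-- The two-sided bound for a finite family: the lower deviations of `φ` are the upper deviations
of `D - φ`, which has the same Lipschitz constant and the same range. -/
lemma measure_exists_abs_deviation_gt_le_of_finite {J : Type*} [Finite J] [Nonempty J]
    (hn : 0 < n) {L D r ρ δ : ℝ} (hL : 0 ≤ L) (hφ : ∀ s t, |φ s - φ t| ≤ L * |s - t|)
    (hD0 : 0 < D) (hD : ∀ t, φ t ∈ Set.Icc 0 D) (hr : 0 ≤ r) (hρ : 0 ≤ ρ) (hw : Measurable w)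
    (hwρ : ∀ x, ‖w x‖ ≤ ρ) (hδ₀ : 0 < δ) (hδ₁ : δ < 1) (θ : J → E) (hθ : ∀ j, ‖θ j‖ ≤ r) :
    (Measure.pi fun _ : Fin n => P) {z | ∃ j, L * (2 * r * ρ / √n) +
        4 * D * √(2 * Real.log (4 / δ) / n) < |deviation P φ w z (θ j)|} ≤
      ENNReal.ofReal δ := by
  have hφc : Continuous φ :=
    (LipschitzWith.of_dist_le_mul (K := ⟨L, hL⟩) fun s t => hφ s t).continuous
  have h1 := measure_exists_deviation_gt_le_of_finite P hn hL hφ hD0 hD hr hρ hw hwρ hδ₀ hδ₁ θ hθ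
  have h2 := measure_exists_deviation_gt_le_of_finite P (φ := fun t => D - φ t) hn hL
    (fun s t => by rw [sub_sub_sub_cancel_left, abs_sub_comm]; exact hφ s t) hD0
    (fun t => ⟨sub_nonneg.2 (hD t).2, by linarith [(hD t).1]⟩) hr hρ hw hwρ hδ₀ hδ₁ θ hθ
  simp only [deviation_const_sub P hn hφc hD hw] at h2
  refine (measure_mono ?_).trans ((measure_union_le _ _).trans ((add_le_add h1 h2).trans ?_))
  · rintro z ⟨j, hj⟩
    rcases lt_abs.1 hj with hj | hj
    · exact Or.inl ⟨j, hj⟩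
    · exact Or.inr ⟨j, hj⟩
  · rw [← ENNReal.ofReal_add (by positivity) (by positivity)]
    exact ENNReal.ofReal_le_ofReal (by linarith)

/-- The uniform bound over the ball. The bad event is the increasing union of those of the first
`k + 1` points of a dense sequence, because the deviation is continuous in `θ`. -/
theorem measure_exists_abs_deviation_gt_le (hn : 0 < n) {L D r ρ δ : ℝ} (hL : 0 ≤ L)
    (hφ : ∀ s t, |φ s - φ t| ≤ L * |s - t|) (hD0 : 0 < D) (hD : ∀ t, φ t ∈ Set.Icc 0 D)
    (hr : 0 ≤ r) (hρ : 0 ≤ ρ) (hw : Measurable w) (hwρ : ∀ x, ‖w x‖ ≤ ρ) (hδ₀ : 0 < δ)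
    (hδ₁ : δ < 1) :
    (Measure.pi fun _ : Fin n => P) {z | ∃ θ ∈ Metric.closedBall (0 : E) r,
        L * (2 * r * ρ / √n) + 4 * D * √(2 * Real.log (4 / δ) / n) < |deviation P φ w z θ|} ≤
      ENNReal.ofReal δ := by
  have hφc : Continuous φ :=
    (LipschitzWith.of_dist_le_mul (K := ⟨L, hL⟩) fun s t => hφ s t).continuous
  have : Nonempty (Metric.closedBall (0 : E) r) := ⟨⟨0, by simpa using hr⟩⟩
  set B := L * (2 * r * ρ / √n) + 4 * D * √(2 * Real.log (4 / δ) / n)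
  let t := TopologicalSpace.denseSeq (Metric.closedBall (0 : E) r)
  let A (k : ℕ) : Set (Fin n → Z) := {z | ∃ j : Fin (k + 1), B < |deviation P φ w z (t j)|}
  have hA : Monotone A := by
    rintro k l hkl z ⟨j, hj⟩
    exact ⟨⟨j, by omega⟩, hj⟩
  have hsub : {z | ∃ θ ∈ Metric.closedBall (0 : E) r, B < |deviation P φ w z θ|} ⊆ ⋃ k, A k := by
    rintro z ⟨θ, hθ, hz⟩
    have hopen : IsOpen {θ : Metric.closedBall (0 : E) r | B < |deviation P φ w z θ|} :=
      isOpen_lt continuous_const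
        ((continuous_deviation P hφc hD hw z).comp continuous_subtype_val).abs
    obtain ⟨k, hk⟩ := (TopologicalSpace.denseRange_denseSeq
      (Metric.closedBall (0 : E) r)).exists_mem_open hopen ⟨⟨θ, hθ⟩, hz⟩
    exact Set.mem_iUnion.2 ⟨k, ⟨k, by omega⟩, hk⟩
  refine (measure_mono hsub).trans ?_
  rw [hA.measure_iUnion]
  exact iSup_le fun k => measure_exists_abs_deviation_gt_le_of_finite P hn hL hφ hD0 hD hr hρ hw
    hwρ hδ₀ hδ₁ (fun j : Fin (k + 1) => (t j : E)) fun j => mem_closedBall_zero_iff.1 (t j).2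

end Ball

/-! ### The logistic model -/

/-- The signed feature `y x` of a labelled feature `(x, y)`, set to `0` outside the ball of radius
`√d`, which contains it almost surely. -/
noncomputable def signedFeature {d : ℕ} (z : EuclideanSpace ℝ (Fin d) × ℝ) :
    EuclideanSpace ℝ (Fin d) :=
  (Metric.closedBall 0 √d).indicator id (z.2 • z.1)

lemma measurable_signedFeature {d : ℕ} : Measurable (signedFeature (d := d)) :=
  (measurable_id.indicator measurableSet_closedBall).comp
    (measurable_snd.smul measurable_fst)

lemma norm_signedFeature_le {d : ℕ} (z : EuclideanSpace ℝ (Fin d) × ℝ) :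
    ‖signedFeature z‖ ≤ √d := by
  unfold signedFeature
  by_cases h : z.2 • z.1 ∈ Metric.closedBall (0 : EuclideanSpace ℝ (Fin d)) √d
  · rw [Set.indicator_of_mem h]
    exact mem_closedBall_zero_iff.1 h
  · simp [Set.indicator_of_notMem h]

lemma norm_le_sqrt_of_mem_Icc {d : ℕ} {x : EuclideanSpace ℝ (Fin d)}
    (hx : ∀ j, x j ∈ Set.Icc (0 : ℝ) 1) : ‖x‖ ≤ √d := by
  rw [EuclideanSpace.norm_eq]
  refine Real.sqrt_le_sqrt ?_
  calc ∑ j, ‖x j‖ ^ 2 ≤ ∑ _j : Fin d, (1 : ℝ) := by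
        refine Finset.sum_le_sum fun j _ => ?_
        rw [Real.norm_of_nonneg (hx j).1]
        exact pow_le_one₀ (hx j).1 (hx j).2
    _ = d := by simp

lemma signedFeature_eq {d : ℕ} {z : EuclideanSpace ℝ (Fin d) × ℝ}
    (hx : ∀ j, z.1 j ∈ Set.Icc (0 : ℝ) 1) (hy : z.2 = -1 ∨ z.2 = 1) :
    signedFeature z = z.2 • z.1 := by
  refine Set.indicator_of_mem (mem_closedBall_zero_iff.2 ?_) id
  have h : |z.2| = 1 := by rcases hy with h | h <;> simp [h]
  rw [norm_smul, Real.norm_eq_abs, h, one_mul]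
  exact norm_le_sqrt_of_mem_Icc hx

lemma clampedLoss_signedFeature {d : ℕ} {α : ℝ≥0∞} {r : ℝ} (hr : 0 ≤ r)
    {θ : EuclideanSpace ℝ (Fin d)} (hθ : ‖θ‖ ≤ r) {z : EuclideanSpace ℝ (Fin d) × ℝ}
    (hz : (∀ j, z.1 j ∈ Set.Icc (0 : ℝ) 1) ∧ (z.2 = -1 ∨ z.2 = 1)) :
    clampedLoss α (r * √d) (inner ℝ θ (signedFeature z)) = logisticLoss α θ z.1 z.2 := by
  rw [clampedLoss_eq, signedFeature_eq hz.1 hz.2]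
  · rfl
  · exact (abs_real_inner_le_norm _ _).trans
      (mul_le_mul hθ (norm_signedFeature_le z) (norm_nonneg _) hr)

end AlphaLoss

theorem mainTheorem3 {d n : ℕ} (hn : 0 < n) (r : ℝ) (hr : 0 < r)
    (α : ℝ≥0∞) (hα : 0 < α) (δ : ℝ) (hδ₀ : 0 < δ) (hδ₁ : δ < 1)
    (P : Measure (EuclideanSpace ℝ (Fin d) × ℝ)) [IsProbabilityMeasure P]
    (hP : ∀ᵐ z ∂P, (∀ j, z.1 j ∈ Set.Icc (0 : ℝ) 1) ∧ (z.2 = -1 ∨ z.2 = 1))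
    {Ω : Type*} [MeasurableSpace Ω] (μ : Measure Ω) [IsProbabilityMeasure μ]
    (X : Fin n → Ω → EuclideanSpace ℝ (Fin d)) (Y : Fin n → Ω → ℝ)
    (hindep : iIndepFun (fun i ω => (X i ω, Y i ω)) μ)
    (hlaw : ∀ i, HasLaw (fun ω => (X i ω, Y i ω)) P μ) :
    ENNReal.ofReal (1 - δ) ≤
      μ {ω | ∀ θ ∈ Metric.closedBall (0 : EuclideanSpace ℝ (Fin d)) r,
        |AlphaLoss.risk P α θ -
            AlphaLoss.empiricalRisk (fun i => X i ω) (fun i => Y i ω) α θ| ≤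
          AlphaLoss.lipConst (r * √(d : ℝ)) α * (2 * r * √(d : ℝ) / √(n : ℝ)) +
            4 * AlphaLoss.boundConst (r * √(d : ℝ)) α *
              √(2 * Real.log (4 / δ) / (n : ℝ))} := by
  have hr₀ : 0 ≤ r * √(d : ℝ) := by positivity
  set S : Ω → Fin n → EuclideanSpace ℝ (Fin d) × ℝ := fun ω i => (X i ω, Y i ω)
  have hS : AEMeasurable S μ := aemeasurable_pi_lambda _ fun i => (hlaw i).aemeasurable
  have hSlaw : μ.map S = Measure.pi fun _ : Fin n => P := by
    rw [(iIndepFun_iff_map_fun_eq_pi_map fun i => (hlaw i).aemeasurable).1 hindep]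
    congr 1
    ext1 i
    exact (hlaw i).map_eq
  have hsupp : ∀ᵐ ω ∂μ, ∀ i, (∀ j, X i ω j ∈ Set.Icc (0 : ℝ) 1) ∧ (Y i ω = -1 ∨ Y i ω = 1) := by
    refine ae_all_iff.2 fun i => ?_
    have h := hP
    rw [← (hlaw i).map_eq] at h
    exact ae_of_ae_map (hlaw i).aemeasurable h
  have hbad := AlphaLoss.measure_exists_abs_deviation_gt_le P (n := n) hn
    (AlphaLoss.lipConst_nonneg hr₀ hα) (AlphaLoss.abs_clampedLoss_sub_le hα hr₀)
    (AlphaLoss.probLoss_sigmoid_pos hα _) (AlphaLoss.clampedLoss_mem_Icc hα (r * √d))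
    hr.le (Real.sqrt_nonneg d) AlphaLoss.measurable_signedFeature
    AlphaLoss.norm_signedFeature_le hδ₀ hδ₁
  rw [← hSlaw, ← AlphaLoss.boundConst_eq] at hbad
  have hbad' := (Measure.le_map_apply hS _).trans hbad
  set G := {ω | ∀ θ ∈ Metric.closedBall (0 : EuclideanSpace ℝ (Fin d)) r,
        |AlphaLoss.risk P α θ -
            AlphaLoss.empiricalRisk (fun i => X i ω) (fun i => Y i ω) α θ| ≤
          AlphaLoss.lipConst (r * √(d : ℝ)) α * (2 * r * √(d : ℝ) / √(n : ℝ)) +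
            4 * AlphaLoss.boundConst (r * √(d : ℝ)) α *
              √(2 * Real.log (4 / δ) / (n : ℝ))}
  have hG : μ Gᶜ ≤ ENNReal.ofReal δ := by
    refine (measure_mono_ae ?_).trans hbad'
    filter_upwards [hsupp] with ω hω hmem
    have hmem' : ω ∉ G := hmem
    simp only [G, Set.mem_ofPred_eq, not_forall, not_le] at hmem'
    obtain ⟨θ, hθ, hlt⟩ := hmem'
    refine ⟨θ, hθ, ?_⟩
    have hθr := mem_closedBall_zero_iff.1 hθ
    convert! hlt using 2
    unfold AlphaLoss.deviation AlphaLoss.risk AlphaLoss.empiricalRisk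
    congr 1
    · refine integral_congr_ae ?_
      filter_upwards [hP] with z hz
      exact AlphaLoss.clampedLoss_signedFeature hr.le hθr hz
    · congr 1
      refine Finset.sum_congr rfl fun i _ => ?_
      exact AlphaLoss.clampedLoss_signedFeature (z := S ω i) hr.le hθr (hω i)
  rw [ENNReal.ofReal_sub _ hδ₀.le, ENNReal.ofReal_one, tsub_le_iff_right]
  calc (1 : ℝ≥0∞) = μ Set.univ := measure_univ.symm
    _ ≤ μ (G ∪ Gᶜ) := by rw [Set.union_compl_self]
    _ ≤ μ G + μ Gᶜ := measure_union_le _ _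
    _ ≤ μ G + ENNReal.ofReal δ := by gcongr
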